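/- Let $1\le p<2$, and let the scalar field $\mathbb K$ be $\mathbb R$ or $\mathbb C$. There is a linear subspace $Y\subseteq L_p(\mathbb R)$ (Lebesgue measure, $\mathbb K$-valued functions) whose elements are regarded as genuine functions $y:\mathbb R\to\mathbb K$ through a choice of one representative for each element of $Y$, the choice being linear in the element, such that the following hold. 1. $Y$, with the $L_p$-norm, is linearly homeomorphic to $\ell_p=\ell_p(\mathbb N,\mathbb K)$. 2. $\sup_{t\in\mathbb R}|y(t)|\le\|y\|_{L_p(\mathbb R)}$ for all $y\in Y$ (in particular $\|y\|_{L_\infty}\le\|y\|_{L_p}$). 3. If $J\subseteq\mathbb R$ is any set such that $\sup_{t\in J}|x(t)|\neq 0$ for all $x\in Y\setminus\{0\}$, then there exists $y\in Y$ with $\sum_{t\in J}|y(t)|^p=\infty$. -/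

import Mathlib

open MeasureTheory
open scoped ENNReal

/-!
The space `Y` is an `ℓ_r`-sum of finite-dimensional spaces of step functions on the line, `r = p`,
with one block for each `k : ℕ`. The block `k` is uniformly isomorphic to some `ℓ_r^I`, but every
set of points separating it from zero already sees some unit vector with `∑ |y(t)| ^ r ≥ 4 ^ k`
(`SamplingBlock`). If `J` separates `Y` from zero then it separates each block; adding up such
vectors, scaled to have `ℓ_r` norm to the power `r` equal to `2 ^ (-k)`, gives a `y ∈ Y` for which
`∑_{t ∈ J} |y(t)| ^ r` exceeds every `2 ^ k`.

A block is made as follows. Take `M` disjoint copies of a finite probability space `Ω` and a linear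
map `g` from `ℓ_r^N` into the functions on these copies, bounded by one both into `L_r` and into
`L_∞` (`SelectionGadget`). The block is spanned by the indicators of the copies of `Ω` and by the
functions `g e_n`, each increased by the indicator of an additional point. The additional points and
the indicators make the system triangular, hence equivalent to the basis of `ℓ_r`. A separating set
detects the indicator of each copy of `Ω`, so it meets every copy, and it suffices that `g`
restricted to any selection of one point in each copy has large norm into `ℓ_r^M`, although `g` is
bounded on average.

* For `r = 1`, let `Ω` have `M` points, let `N` be the set of all selections, and map `e_σ` to the
  indicator of the graph of `σ`: each such function has norm one in `L_1`, but on the selection `σ`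
  it sums to `M` (`nonempty_selectionGadget_one`).
* For `1 < r < 2`, map `e_n` to `N ^ (-1/q) ε_n` with `ε_n` Rademacher functions and `q` conjugate
  to `r`, and let `M` be about `N ^ (r - 1)`. On average `g` is bounded because a Rademacher sum has
  `L_r` norm at most the `ℓ_2` norm, which is at most the `ℓ_r` norm, of its coefficients
  (`sum_norm_boolSign_rpow_le`). A selection is an `M × N` sign matrix; some signed sum of its rows
  has squared Euclidean norm at least `M N`, and this sum is a vector on which the norm is at least
  `M ^ (1 / r - 1 / 2)` (`exists_rpow_mul_sum_le_of_signs`). This is large since `r < 2`.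
-/

/-! ### Power means and random signs -/

theorem enorm_rpow_eq_ofReal {E : Type*} [SeminormedAddCommGroup E] (x : E) {r : ℝ} (hr : 0 ≤ r) :
    ‖x‖ₑ ^ r = ENNReal.ofReal (‖x‖ ^ r) := by
  rw [← ofReal_norm, ENNReal.ofReal_rpow_of_nonneg (norm_nonneg x) hr]

theorem sum_enorm_rpow_eq_ofReal {ι E : Type*} [SeminormedAddCommGroup E] (s : Finset ι)
    (f : ι → E) {r : ℝ} (hr : 0 ≤ r) :
    ∑ i ∈ s, ‖f i‖ₑ ^ r = ENNReal.ofReal (∑ i ∈ s, ‖f i‖ ^ r) := by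
  rw [ENNReal.ofReal_sum_of_nonneg fun i _ => by positivity]
  exact Finset.sum_congr rfl fun i _ => enorm_rpow_eq_ofReal _ hr

/-- Comparison of the `r`-th and the second moment on a finite set, for `0 < r ≤ 2`. -/
theorem sum_rpow_le_card_rpow_mul_sum_sq_rpow {ι : Type*} [Fintype ι] (f : ι → ℝ)
    (hf : ∀ i, 0 ≤ f i) {r : ℝ} (hr : 0 < r) (hr2 : r ≤ 2) :
    ∑ i, f i ^ r ≤ (Fintype.card ι : ℝ) ^ (1 - r / 2) * (∑ i, f i ^ 2) ^ (r / 2) := by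
  have h := Real.rpow_sum_le_const_mul_sum_rpow_of_nonneg (s := Finset.univ) (f := fun i => f i ^ r)
    (p := 2 / r) (by rw [le_div_iff₀ hr]; linarith) (fun i _ => Real.rpow_nonneg (hf i) r)
  have h2 : ∀ i, (f i ^ r) ^ (2 / r) = f i ^ 2 := fun i => by
    rw [← Real.rpow_mul (hf i), mul_div_cancel₀ _ hr.ne', Real.rpow_two]
  simp only [h2, Finset.card_univ] at h
  have hS : 0 ≤ ∑ i, f i ^ r := Finset.sum_nonneg fun i _ => Real.rpow_nonneg (hf i) r
  have h3 := Real.rpow_le_rpow (by positivity) h (by positivity : 0 ≤ r / 2)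
  rw [← Real.rpow_mul hS, Real.mul_rpow (by positivity) (Finset.sum_nonneg fun i _ => sq_nonneg _),
    ← Real.rpow_mul (by positivity)] at h3
  convert h3 using 2
  · rw [div_mul_div_comm, mul_comm, div_self (by positivity), Real.rpow_one]
  · congr 1; field_simp

theorem rpow_sum_le_sum_rpow_of_le_one {ι : Type*} (s : Finset ι) (f : ι → ℝ) (hf : ∀ i, 0 ≤ f i)
    {q : ℝ} (hq : 0 < q) (hq1 : q ≤ 1) :
    (∑ i ∈ s, f i) ^ q ≤ ∑ i ∈ s, f i ^ q := by
  lift f to ι → NNReal using hf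
  have := Finset.le_sum_of_subadditive (fun x : NNReal => x ^ q) (NNReal.zero_rpow hq.ne').le
    (fun a b => NNReal.rpow_add_le_add_rpow a b hq.le hq1) s f
  simp only
  exact_mod_cast this

/-- The sign attached to a truth value. -/
def boolSign (b : Bool) : ℝ := if b then 1 else -1

theorem abs_boolSign (b : Bool) : |boolSign b| = 1 := by cases b <;> simp [boolSign]

/-- The second moment of a Rademacher sum, by the parallelogram law. The translation `x` makes the
induction go through. -/
theorem sum_norm_sq_add_boolSign (𝕜 : Type*) [RCLike 𝕜] (n : ℕ) (a : Fin n → 𝕜) (x : 𝕜) :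
    ∑ ω : Fin n → Bool, ‖x + ∑ i, (boolSign (ω i) : 𝕜) * a i‖ ^ 2
      = 2 ^ n * (‖x‖ ^ 2 + ∑ i, ‖a i‖ ^ 2) := by
  induction n generalizing x with
  | zero => simp
  | succ n ih =>
    rw [← (Fin.consEquiv fun _ : Fin (n + 1) => Bool).sum_comp, Fintype.sum_prod_type,
      Fintype.sum_bool]
    simp only [Fin.consEquiv_apply, Fin.sum_univ_succ, Fin.cons_zero, Fin.cons_succ, ← add_assoc]
    rw [ih, ih]
    have h := parallelogram_law_with_norm 𝕜 x (a 0)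
    simp only [boolSign, if_true, Bool.false_eq_true, if_false, RCLike.ofReal_neg,
      RCLike.ofReal_one, one_mul, neg_mul, ← sub_eq_add_neg]
    rw [pow_succ]
    linear_combination (2 : ℝ) ^ n * h

theorem sum_norm_boolSign_rpow_le (𝕜 : Type*) [RCLike 𝕜] (n : ℕ) (a : Fin n → 𝕜) {r : ℝ}
    (hr : 0 < r) (hr2 : r ≤ 2) :
    ∑ ω : Fin n → Bool, ‖∑ i, (boolSign (ω i) : 𝕜) * a i‖ ^ r ≤ 2 ^ n * ∑ i, ‖a i‖ ^ r := by
  have h1 := sum_rpow_le_card_rpow_mul_sum_sq_rpow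
    (fun ω : Fin n → Bool => ‖∑ i, (boolSign (ω i) : 𝕜) * a i‖) (fun _ => norm_nonneg _) hr hr2
  have h2 := sum_norm_sq_add_boolSign 𝕜 n a 0
  simp only [zero_add, norm_zero, ne_eq, OfNat.ofNat_ne_zero, not_false_eq_true, zero_pow] at h2
  rw [h2] at h1
  have hcard : (Fintype.card (Fin n → Bool) : ℝ) = 2 ^ n := by simp
  rw [hcard, Real.mul_rpow (by positivity) (by positivity), ← mul_assoc,
    ← Real.rpow_add (by positivity), sub_add_cancel, Real.rpow_one] at h1
  refine h1.trans (mul_le_mul_of_nonneg_left ?_ (by positivity))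
  refine (rpow_sum_le_sum_rpow_of_le_one _ _ (fun i => by positivity) (by positivity)
    (by linarith)).trans (Finset.sum_le_sum fun i _ => ?_)
  rw [← Real.rpow_two, ← Real.rpow_mul (norm_nonneg _), mul_div_cancel₀ _ two_ne_zero]

/-- Signs can be chosen one after the other so that each new vector increases the squared norm of
the signed sum by at least its own squared norm. -/
theorem exists_signs_sum_norm_sq_le {ι E : Type*} [NormedAddCommGroup E] [InnerProductSpace ℝ E]
    (s : Finset ι) (v : ι → E) :
    ∃ c : ι → ℝ, (∀ i, |c i| = 1) ∧ ∑ i ∈ s, ‖v i‖ ^ 2 ≤ ‖∑ i ∈ s, c i • v i‖ ^ 2 := by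
  classical
  induction s using Finset.induction_on with
  | empty => exact ⟨fun _ => 1, by simp, by simp⟩
  | insert j s hj ih =>
    obtain ⟨c, hc, h⟩ := ih
    have key : ∀ ε : ℝ, ∑ i ∈ insert j s, Function.update c j ε i • v i
        = ε • v j + ∑ i ∈ s, c i • v i := by
      intro ε
      rw [Finset.sum_insert hj, Function.update_self]
      congr 1
      exact Finset.sum_congr rfl fun i hi => by
        rw [Function.update_of_ne (ne_of_mem_of_not_mem hi hj)]
    have hup : ∀ ε : ℝ, |ε| = 1 → ∀ i, |Function.update c j ε i| = 1 := by
      intro ε hε i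
      by_cases hi : i = j
      · subst hi; simpa using hε
      · simpa [Function.update_of_ne hi] using hc i
    have par := parallelogram_law_with_norm ℝ (∑ i ∈ s, c i • v i) (v j)
    rw [Finset.sum_insert hj]
    rcases le_total ‖∑ i ∈ s, c i • v i - v j‖ ‖∑ i ∈ s, c i • v i + v j‖ with hle | hle
    · refine ⟨Function.update c j 1, hup 1 (by simp), ?_⟩
      rw [key 1, one_smul, add_comm (v j)]
      nlinarith [norm_nonneg (∑ i ∈ s, c i • v i - v j)]
    · refine ⟨Function.update c j (-1), hup (-1) (by simp), ?_⟩
      rw [key (-1), neg_one_smul, neg_add_eq_sub]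
      nlinarith [norm_nonneg (∑ i ∈ s, c i • v i + v j)]

/-- Any sign matrix with `M` rows and `n` columns, scaled so that its rows define functionals of
norm one on `ℓ_r^n`, has norm at least `M ^ (1 / r - 1 / 2)` from `ℓ_r^n` to `ℓ_r^M`. -/
theorem exists_rpow_mul_sum_le_of_signs {M n : ℕ} (hM : 0 < M) (hn : 0 < n) {r : ℝ} (hr : 1 ≤ r)
    (hr2 : r ≤ 2) (ω : Fin M → Fin n → Bool) :
    ∃ a : Fin n → ℝ, a ≠ 0 ∧ (M : ℝ) ^ (1 - r / 2) * ∑ i, |a i| ^ r ≤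
      (n : ℝ) ^ (-(r - 1)) * ∑ m, |∑ i, boolSign (ω m i) * a i| ^ r := by
  have hM' : (0 : ℝ) < M := by exact_mod_cast hM
  have hn' : (0 : ℝ) < n := by exact_mod_cast hn
  let s : Fin M → EuclideanSpace ℝ (Fin n) := fun m => WithLp.toLp 2 fun i => boolSign (ω m i)
  obtain ⟨c, hc, hle⟩ := exists_signs_sum_norm_sq_le Finset.univ s
  set v := ∑ m, c m • s m with hv
  have hs : ∀ m, ‖s m‖ ^ 2 = n := fun m => by
    rw [EuclideanSpace.real_norm_sq_eq]
    have : ∀ i, boolSign (ω m i) ^ 2 = 1 := fun i => by rw [← sq_abs, abs_boolSign, one_pow]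
    simp [s, this]
  have hS : (M * n : ℝ) ≤ ‖v‖ ^ 2 := by simpa [hs] using hle
  have hv0 : 0 < ‖v‖ ^ 2 := lt_of_lt_of_le (by positivity) hS
  set S := ‖v‖ ^ 2 with hSdef
  have hin : ∀ m, inner ℝ v (s m) = ∑ i, boolSign (ω m i) * v i := fun m => by
    simp [PiLp.inner_apply, s]
  -- the signs `c` witness that the `ℓ_1` norm of the image of `v` is at least `‖v‖ ^ 2`
  have hsum : S ≤ ∑ m, |∑ i, boolSign (ω m i) * v i| := by
    have : S = ∑ m, c m * inner ℝ v (s m) := by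
      rw [hSdef, ← real_inner_self_eq_norm_sq]
      nth_rewrite 2 [hv]
      rw [inner_sum]
      exact Finset.sum_congr rfl fun m _ => by rw [inner_smul_right]
    rw [this]
    refine Finset.sum_le_sum fun m _ => (le_abs_self _).trans ?_
    rw [abs_mul, hc, one_mul, hin]
  have h1 : S ^ r ≤ (M : ℝ) ^ (r - 1) * ∑ m, |∑ i, boolSign (ω m i) * v i| ^ r := by
    have := Real.rpow_sum_le_const_mul_sum_rpow Finset.univ
      (fun m => ∑ i, boolSign (ω m i) * v i) hr
    rw [Finset.card_univ, Fintype.card_fin] at this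
    exact (Real.rpow_le_rpow hv0.le hsum (by linarith)).trans this
  have h2 : ∑ i, |v i| ^ r ≤ (n : ℝ) ^ (1 - r / 2) * S ^ (r / 2) := by
    have := sum_rpow_le_card_rpow_mul_sum_sq_rpow (fun i => |v i|) (fun i => abs_nonneg _)
      (by linarith : 0 < r) hr2
    simpa [hSdef, EuclideanSpace.real_norm_sq_eq] using this
  refine ⟨fun i => v i, ?_, ?_⟩
  · intro h0
    have : v = 0 := by ext i; exact congrFun h0 i
    rw [hSdef, this] at hv0
    simp at hv0
  have h3 : (M * n : ℝ) ^ (r / 2) ≤ S ^ (r / 2) := Real.rpow_le_rpow (by positivity) hS (by linarith)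
  have hMM : (M : ℝ) ^ (1 - r / 2) = (M : ℝ) ^ (-(r - 1)) * (M : ℝ) ^ (r / 2) := by
    rw [← Real.rpow_add hM']; congr 1; ring
  have hnn : (n : ℝ) ^ (1 - r / 2) = (n : ℝ) ^ (-(r - 1)) * (n : ℝ) ^ (r / 2) := by
    rw [← Real.rpow_add hn']; congr 1; ring
  have hSS : S ^ r = S ^ (r / 2) * S ^ (r / 2) := by
    rw [← Real.rpow_add hv0]; congr 1; ring
  have hMi : (M : ℝ) ^ (-(r - 1)) * (M : ℝ) ^ (r - 1) = 1 := by
    rw [← Real.rpow_add hM']; simp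
  calc (M : ℝ) ^ (1 - r / 2) * ∑ i, |v i| ^ r
      ≤ (M : ℝ) ^ (1 - r / 2) * ((n : ℝ) ^ (1 - r / 2) * S ^ (r / 2)) := by gcongr
    _ = (n : ℝ) ^ (-(r - 1)) * ((M : ℝ) ^ (-(r - 1)) * ((M * n : ℝ) ^ (r / 2) * S ^ (r / 2))) := by
        rw [hMM, hnn, Real.mul_rpow hM'.le hn'.le]; ring
    _ ≤ (n : ℝ) ^ (-(r - 1)) * ((M : ℝ) ^ (-(r - 1)) * S ^ r) := by
        rw [hSS]; gcongr
    _ ≤ (n : ℝ) ^ (-(r - 1)) * ((M : ℝ) ^ (-(r - 1)) *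
          ((M : ℝ) ^ (r - 1) * ∑ m, |∑ i, boolSign (ω m i) * v i| ^ r)) := by gcongr
    _ = _ := by rw [← mul_assoc ((M : ℝ) ^ (-(r - 1))), hMi, one_mul]

/-! ### Families that are bounded on average but unbounded on every selection -/

/-- A linear map `g` from `𝕜 ^ N` into functions on `M` copies of a finite probability space `Ω`,
which is bounded by one from `ℓ_r` to `L_r` (`sum_le`) and to `L_∞` (`le_sum`), while each choice of
one point in each copy of `Ω` gives a map into `ℓ_r^M` of norm at least `G ^ (1 / r)` (`gain`). -/
structure SelectionGadget (𝕜 : Type*) [RCLike 𝕜] (r : ℝ) (G : ℕ) where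
  M : ℕ
  N : Type
  Ω : Type
  [fintypeN : Fintype N]
  [fintypeΩ : Fintype Ω]
  [nonemptyΩ : Nonempty Ω]
  g : (N → 𝕜) →ₗ[𝕜] (Fin M × Ω → 𝕜)
  sum_le : ∀ a, ∑ x, ‖g a x‖ₑ ^ r ≤ (Fintype.card Ω : ℝ≥0∞) * ∑ n, ‖a n‖ₑ ^ r
  le_sum : ∀ a x, ‖g a x‖ₑ ^ r ≤ ∑ n, ‖a n‖ₑ ^ r
  gain : ∀ ω : Fin M → Ω, ∃ a, a ≠ 0 ∧
    (G : ℝ≥0∞) * ∑ n, ‖a n‖ₑ ^ r ≤ ∑ m, ‖g a (m, ω m)‖ₑ ^ r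

attribute [instance] SelectionGadget.fintypeN SelectionGadget.fintypeΩ SelectionGadget.nonemptyΩ

/-- For `r = 1` the coordinates are indexed by the selections `σ` themselves, and the function
attached to `σ` is the indicator of the graph of `σ`. -/
theorem nonempty_selectionGadget_one (𝕜 : Type*) [RCLike 𝕜] (G : ℕ) :
    Nonempty (SelectionGadget 𝕜 1 G) := by
  classical
  let K := G + 1
  let g : ((Fin K → Fin K) → 𝕜) →ₗ[𝕜] (Fin K × Fin K → 𝕜) :=
    { toFun := fun a x => ∑ σ : Fin K → Fin K, if σ x.1 = x.2 then a σ else 0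
      map_add' := fun a b => by
        funext x
        simp only [Pi.add_apply, ← Finset.sum_add_distrib]
        exact Finset.sum_congr rfl fun σ _ => by split_ifs <;> simp
      map_smul' := fun c a => by
        funext x
        simp only [Pi.smul_apply, Finset.smul_sum, RingHom.id_apply]
        exact Finset.sum_congr rfl fun σ _ => by split_ifs <;> simp }
  have hg : ∀ a x, g a x = ∑ σ : Fin K → Fin K, if σ x.1 = x.2 then a σ else 0 := fun _ _ => rfl
  have hle : ∀ a x, ‖g a x‖ₑ ≤ ∑ σ : Fin K → Fin K, if σ x.1 = x.2 then ‖a σ‖ₑ else 0 := by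
    intro a x
    rw [hg]
    refine (enorm_sum_le _ _).trans (Finset.sum_le_sum fun σ _ => ?_)
    split_ifs <;> simp
  refine ⟨{ M := K, N := Fin K → Fin K, Ω := Fin K, g := g, sum_le := ?_, le_sum := ?_, gain := ?_ }⟩
  · intro a
    simp only [ENNReal.rpow_one]
    refine (Finset.sum_le_sum fun x _ => hle a x).trans ?_
    rw [Finset.sum_comm, Finset.mul_sum]
    refine Finset.sum_le_sum fun σ _ => le_of_eq ?_
    rw [Fintype.sum_prod_type]
    simp
  · intro a x
    simp only [ENNReal.rpow_one]
    refine (hle a x).trans (Finset.sum_le_sum fun σ _ => ?_)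
    split_ifs <;> simp
  · intro ω
    refine ⟨Pi.single ω 1, by simp, ?_⟩
    have h1 : ∀ m, g (Pi.single ω 1) (m, ω m) = 1 := by
      intro m
      rw [hg, Finset.sum_eq_single ω]
      · simp
      · intro σ _ hσ; simp [Pi.single_eq_of_ne hσ]
      · simp
    have h2 : ∑ n, ‖(Pi.single ω 1 : (Fin K → Fin K) → 𝕜) n‖ₑ ^ (1 : ℝ) = 1 := by
      rw [Finset.sum_eq_single ω]
      · simp
      · intro σ _ hσ; simp [Pi.single_eq_of_ne hσ]
      · simp
    rw [h2]
    simp [h1, K]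

/-- For `1 < r < 2` the functions are Rademacher functions scaled by the reciprocal of the norm of
the all-ones functional on `ℓ_r^n`. There is room for about `n ^ (r - 1)` copies of `Ω`, and since
`r < 2` the gain `M ^ (1 - r / 2)` tends to infinity. -/
theorem nonempty_selectionGadget_of_one_lt (𝕜 : Type*) [RCLike 𝕜] {r : ℝ} (hr : 1 < r)
    (hr2 : r < 2) (G : ℕ) : Nonempty (SelectionGadget 𝕜 r G) := by
  classical
  have hr0 : 0 ≤ r := by linarith
  obtain ⟨M, hMG, hM0⟩ : ∃ M : ℕ, (G : ℝ) ≤ (M : ℝ) ^ (1 - r / 2) ∧ 0 < M :=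
    ((((tendsto_rpow_atTop (by linarith : 0 < 1 - r / 2)).comp
      tendsto_natCast_atTop_atTop).eventually_ge_atTop (G : ℝ)).and
        (Filter.eventually_gt_atTop 0)).exists
  obtain ⟨n, hnM, hn0⟩ : ∃ n : ℕ, (M : ℝ) ≤ (n : ℝ) ^ (r - 1) ∧ 0 < n :=
    ((((tendsto_rpow_atTop (by linarith : 0 < r - 1)).comp
      tendsto_natCast_atTop_atTop).eventually_ge_atTop (M : ℝ)).and
        (Filter.eventually_gt_atTop 0)).exists
  have hn' : (0 : ℝ) < n := by exact_mod_cast hn0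
  -- the scaling factor satisfies `δ ^ r = n ^ (-(r - 1))`
  let δ : ℝ := (n : ℝ) ^ (-(r - 1) / r)
  have hδ0 : 0 ≤ δ := by positivity
  have hδ : δ ^ r = (n : ℝ) ^ (-(r - 1)) := by
    rw [← Real.rpow_mul hn'.le, div_mul_cancel₀ _ (by linarith)]
  have hδn : δ ^ r * (n : ℝ) ^ (r - 1) = 1 := by
    rw [hδ, ← Real.rpow_add hn']; simp
  let g : (Fin n → 𝕜) →ₗ[𝕜] (Fin M × (Fin n → Bool) → 𝕜) :=
    { toFun := fun a x => (δ : 𝕜) * ∑ i, (boolSign (x.2 i) : 𝕜) * a i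
      map_add' := fun a b => by
        funext x
        simp only [Pi.add_apply, mul_add, Finset.sum_add_distrib]
      map_smul' := fun c a => by
        funext x
        simp only [Pi.smul_apply, smul_eq_mul, RingHom.id_apply, Finset.mul_sum]
        exact Finset.sum_congr rfl fun σ _ => by ring }
  have hg : ∀ a x, ‖g a x‖ ^ r = δ ^ r * ‖∑ i, (boolSign (x.2 i) : 𝕜) * a i‖ ^ r := by
    intro a x
    rw [← Real.mul_rpow hδ0 (norm_nonneg _)]
    change ‖(δ : 𝕜) * _‖ ^ r = _
    rw [norm_mul, RCLike.norm_ofReal, abs_of_nonneg hδ0]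
  refine ⟨{ M := M, N := Fin n, Ω := Fin n → Bool, g := g, sum_le := ?_, le_sum := ?_,
            gain := ?_ }⟩
  · intro a
    rw [sum_enorm_rpow_eq_ofReal _ _ hr0, sum_enorm_rpow_eq_ofReal _ _ hr0,
      ← ENNReal.ofReal_natCast, ← ENNReal.ofReal_mul (Nat.cast_nonneg _)]
    apply ENNReal.ofReal_le_ofReal
    rw [Fintype.sum_prod_type]
    simp only [hg, Finset.sum_const, Finset.card_univ, Fintype.card_fin, nsmul_eq_mul,
      ← Finset.mul_sum]
    have h := sum_norm_boolSign_rpow_le 𝕜 n a (by linarith : 0 < r) hr2.le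
    calc (M : ℝ) * (δ ^ r * ∑ ω : Fin n → Bool, ‖∑ i, (boolSign (ω i) : 𝕜) * a i‖ ^ r)
        ≤ (n : ℝ) ^ (r - 1) * (δ ^ r * (2 ^ n * ∑ i, ‖a i‖ ^ r)) := by gcongr
      _ = (δ ^ r * (n : ℝ) ^ (r - 1)) * (2 ^ n * ∑ i, ‖a i‖ ^ r) := by ring
      _ = _ := by rw [hδn]; simp
  · intro a x
    rw [sum_enorm_rpow_eq_ofReal _ _ hr0, enorm_rpow_eq_ofReal _ hr0]
    apply ENNReal.ofReal_le_ofReal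
    rw [hg]
    have h1 : ‖∑ i, (boolSign (x.2 i) : 𝕜) * a i‖ ≤ ∑ i, ‖a i‖ := by
      refine (norm_sum_le _ _).trans (Finset.sum_le_sum fun i _ => ?_)
      rw [norm_mul, RCLike.norm_ofReal, abs_boolSign, one_mul]
    have h2 := Real.rpow_sum_le_const_mul_sum_rpow_of_nonneg (s := Finset.univ)
      (f := fun i => ‖a i‖) hr.le fun i _ => norm_nonneg _
    rw [Finset.card_univ, Fintype.card_fin] at h2
    calc δ ^ r * ‖∑ i, (boolSign (x.2 i) : 𝕜) * a i‖ ^ r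
        ≤ δ ^ r * ((n : ℝ) ^ (r - 1) * ∑ i, ‖a i‖ ^ r) := by
          gcongr
          exact (Real.rpow_le_rpow (norm_nonneg _) h1 hr0).trans h2
      _ = _ := by rw [← mul_assoc, hδn, one_mul]
  · intro ω
    obtain ⟨a, ha0, ha⟩ := exists_rpow_mul_sum_le_of_signs hM0 hn0 hr.le hr2.le ω
    refine ⟨fun i => (a i : 𝕜), fun h => ha0 (funext fun i => ?_), ?_⟩
    · simpa using congrFun h i
    · rw [sum_enorm_rpow_eq_ofReal _ _ hr0, sum_enorm_rpow_eq_ofReal _ _ hr0,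
        ← ENNReal.ofReal_natCast, ← ENNReal.ofReal_mul (Nat.cast_nonneg _)]
      apply ENNReal.ofReal_le_ofReal
      have h3 : ∀ m, ‖∑ i, (boolSign (ω m i) : 𝕜) * (a i : 𝕜)‖ = |∑ i, boolSign (ω m i) * a i| := by
        intro m
        rw [← RCLike.norm_ofReal (K := 𝕜)]
        push_cast
        rfl
      simp only [hg, h3, RCLike.norm_ofReal, ← Finset.mul_sum, hδ]
      refine le_trans ?_ ha
      gcongr

theorem nonempty_selectionGadget (𝕜 : Type*) [RCLike 𝕜] {r : ℝ} (hr : 1 ≤ r) (hr2 : r < 2)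
    (G : ℕ) : Nonempty (SelectionGadget 𝕜 r G) := by
  rcases hr.eq_or_lt with rfl | h
  · exact nonempty_selectionGadget_one 𝕜 G
  · exact nonempty_selectionGadget_of_one_lt 𝕜 h hr2 G

/-! ### Blocks for which separating sets are not Bessel -/

/-- A finite-dimensional space of functions `F a` on a finite set `X` with weights `w ≤ 6`, which
is uniformly isomorphic to `ℓ_r^I`, on which the supremum norm is dominated by the weighted `ℓ_r`
norm, and such that restriction to any set `J` that separates the space from zero has norm at least
`G ^ (1 / r)` as a map from `ℓ_r^I` to `ℓ_r(J)`. The bound `6` on the weights lets the points of a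
block be replaced by intervals of length `w x` inside disjoint intervals of length `6`; it is large
enough for the factor `2` in `le_sum` to match the one in `apply_le`. -/
structure SamplingBlock (𝕜 : Type*) [RCLike 𝕜] (r : ℝ) (G : ℕ) where
  I : Type
  X : Type
  [fintypeI : Fintype I]
  [fintypeX : Fintype X]
  [nonemptyI : Nonempty I]
  w : X → ℝ≥0∞
  w_le : ∀ x, w x ≤ 6
  F : (I → 𝕜) →ₗ[𝕜] (X → 𝕜)
  le_sum : ∀ a, 2 * ∑ i, ‖a i‖ₑ ^ r ≤ ∑ x, ‖F a x‖ₑ ^ r * w x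
  sum_le : ∀ a, ∑ x, ‖F a x‖ₑ ^ r * w x ≤ 18 * ∑ i, ‖a i‖ₑ ^ r
  apply_le : ∀ a x, ‖F a x‖ₑ ^ r ≤ 2 * ∑ i, ‖a i‖ₑ ^ r
  gain : ∀ J : Finset X, (∀ a, a ≠ 0 → ∃ x ∈ J, F a x ≠ 0) →
    ∃ a, a ≠ 0 ∧ (G : ℝ≥0∞) * ∑ i, ‖a i‖ₑ ^ r ≤ ∑ x ∈ J, ‖F a x‖ₑ ^ r

attribute [instance] SamplingBlock.fintypeI SamplingBlock.fintypeX SamplingBlock.nonemptyI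

theorem enorm_add_rpow_le {E : Type*} [NormedAddCommGroup E] (x y : E) {r : ℝ} (hr : 1 ≤ r)
    (hr2 : r ≤ 2) : ‖x + y‖ₑ ^ r ≤ 2 * (‖x‖ₑ ^ r + ‖y‖ₑ ^ r) := by
  refine (ENNReal.rpow_le_rpow (enorm_add_le x y) (by linarith)).trans
    ((ENNReal.rpow_add_le_mul_rpow_add_rpow _ _ hr).trans ?_)
  gcongr
  calc (2 : ℝ≥0∞) ^ (r - 1) ≤ 2 ^ (1 : ℝ) :=
        ENNReal.rpow_le_rpow_of_exponent_le (by norm_num) (by linarith)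
    _ = 2 := ENNReal.rpow_one 2

/-- The block consists of one coordinate `m` for each copy of `Ω`, represented by the constant
function on that copy, and of the coordinates of the gadget, each of which has a point of its own in
addition to its values on the copies of `Ω`. A separating set meets every copy of `Ω`, because it
detects the constant function there. -/
theorem SelectionGadget.nonempty_samplingBlock {𝕜 : Type*} [RCLike 𝕜] {r : ℝ} (hr : 1 ≤ r)
    (hr2 : r ≤ 2) {G : ℕ} (g : SelectionGadget 𝕜 r G) :
    Nonempty (SamplingBlock 𝕜 r G) := by
  classical
  have hr0 : 0 < r := by linarith
  let c : ℝ≥0∞ := Fintype.card g.Ω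
  have hc1 : 1 ≤ c := by simpa [c] using Nat.one_le_iff_ne_zero.mpr Fintype.card_ne_zero
  have hc0 : c ≠ 0 := (zero_lt_one.trans_le hc1).ne'
  have hct : c ≠ ∞ := ENNReal.natCast_ne_top _
  let F : ((Fin g.M ⊕ g.N) → 𝕜) →ₗ[𝕜] ((Fin g.M × g.Ω) ⊕ g.N → 𝕜) :=
    { toFun := fun a => Sum.elim (fun x => a (.inl x.1) + g.g (fun n => a (.inr n)) x)
        (fun n => a (.inr n))
      map_add' := fun a b => by
        funext x
        have : g.g (fun n => a (.inr n) + b (.inr n))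
          = g.g (fun n => a (.inr n)) + g.g (fun n => b (.inr n)) := map_add _ _ _
        rcases x with x | n
        · simp only [Sum.elim_inl, Pi.add_apply, this]; ring
        · simp
      map_smul' := fun k a => by
        funext x
        have : g.g (fun n => k • a (.inr n)) = k • g.g (fun n => a (.inr n)) :=
          map_smul g.g k fun n => a (.inr n)
        rcases x with x | n
        · simp only [Sum.elim_inl, Pi.smul_apply, this, RingHom.id_apply, smul_add]
        · simp }
  have hFl : ∀ a x, F a (.inl x) = a (.inl x.1) + g.g (fun n => a (.inr n)) x := fun _ _ => rfl
  have hFr : ∀ a n, F a (.inr n) = a (.inr n) := fun _ _ => rfl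
  let w : (Fin g.M × g.Ω) ⊕ g.N → ℝ≥0∞ := Sum.elim (fun _ => 6 * c⁻¹) (fun _ => 6)
  have hsum : ∀ a, ∑ x, ‖F a x‖ₑ ^ r * w x = 6 * (c⁻¹ * ∑ x, ‖F a (.inl x)‖ₑ ^ r
      + ∑ n, ‖a (.inr n)‖ₑ ^ r) := by
    intro a
    rw [Fintype.sum_sum_type]
    simp only [w, Sum.elim_inl, Sum.elim_inr, ← Finset.sum_mul, hFr]
    ring
  have hI : ∀ a : Fin g.M ⊕ g.N → 𝕜, ∑ i, ‖a i‖ₑ ^ r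
      = ∑ m, ‖a (.inl m)‖ₑ ^ r + ∑ n, ‖a (.inr n)‖ₑ ^ r := fun a => Fintype.sum_sum_type _
  have hconst : ∀ a : Fin g.M ⊕ g.N → 𝕜, ∑ x : Fin g.M × g.Ω, ‖a (.inl x.1)‖ₑ ^ r
      = c * ∑ m, ‖a (.inl m)‖ₑ ^ r := by
    intro a
    rw [Fintype.sum_prod_type, Finset.mul_sum]
    simp [c]
  have hgs : ∀ a : Fin g.M ⊕ g.N → 𝕜, ∑ x, ‖g.g (fun n => a (.inr n)) x‖ₑ ^ r
    ≤ c * ∑ n, ‖a (.inr n)‖ₑ ^ r := fun a => g.sum_le _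
  have hcc : c⁻¹ * c = 1 := ENNReal.inv_mul_cancel hc0 hct
  have hnon : Nonempty (Fin g.M ⊕ g.N) := by
    obtain ⟨a, ha, -⟩ := g.gain fun _ => Classical.arbitrary _
    obtain ⟨n, -⟩ := Function.ne_iff.mp ha
    exact ⟨.inr n⟩
  refine ⟨{ I := Fin g.M ⊕ g.N, X := (Fin g.M × g.Ω) ⊕ g.N, w := w, w_le := ?_, F := F,
            le_sum := ?_, sum_le := ?_, apply_le := ?_, gain := ?_ }⟩
  · rintro (x | n)
    · calc 6 * c⁻¹ ≤ 6 * 1 := by gcongr; exact ENNReal.inv_le_one.mpr hc1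
        _ = 6 := mul_one _
    · exact le_rfl
  · intro a
    rw [hsum, hI]
    -- recover the constants from `F a` by subtracting the perturbation `g`
    have h1 : ∑ x : Fin g.M × g.Ω, ‖a (.inl x.1)‖ₑ ^ r
        ≤ 2 * (∑ x, ‖F a (.inl x)‖ₑ ^ r + c * ∑ n, ‖a (.inr n)‖ₑ ^ r) := by
      refine le_trans ?_ (mul_le_mul_right (add_le_add_right (hgs a) _) 2)
      rw [← Finset.sum_add_distrib, Finset.mul_sum]
      refine Finset.sum_le_sum fun x _ => ?_
      have := enorm_add_rpow_le (F a (.inl x)) (-g.g (fun n => a (.inr n)) x) hr hr2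
      rwa [enorm_neg, hFl, add_neg_cancel_right, ← hFl] at this
    rw [hconst] at h1
    have h2 := mul_le_mul_right h1 c⁻¹
    rw [← mul_assoc, hcc, one_mul, mul_left_comm, mul_add, ← mul_assoc c⁻¹ c, hcc, one_mul] at h2
    set A := ∑ m, ‖a (.inl m)‖ₑ ^ r
    set B := ∑ n, ‖a (.inr n)‖ₑ ^ r
    set T := c⁻¹ * ∑ x, ‖F a (.inl x)‖ₑ ^ r
    calc 2 * (A + B) ≤ 2 * (2 * (T + B) + B) := by gcongr
      _ = 4 * T + 6 * B := by ring
      _ ≤ 6 * T + 6 * B := by gcongr; norm_num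
      _ = 6 * (T + B) := by ring
  · intro a
    rw [hsum, hI]
    have h1 : ∑ x, ‖F a (.inl x)‖ₑ ^ r
        ≤ 2 * (c * ∑ m, ‖a (.inl m)‖ₑ ^ r + c * ∑ n, ‖a (.inr n)‖ₑ ^ r) := by
      refine le_trans ?_ (mul_le_mul_right (add_le_add_right (hgs a) _) 2)
      rw [← hconst, ← Finset.sum_add_distrib, Finset.mul_sum]
      exact Finset.sum_le_sum fun x _ => enorm_add_rpow_le _ _ hr hr2
    have h2 := mul_le_mul_right h1 c⁻¹
    rw [← mul_add, mul_left_comm, ← mul_assoc c⁻¹ c, hcc, one_mul] at h2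
    set A := ∑ m, ‖a (.inl m)‖ₑ ^ r
    set B := ∑ n, ‖a (.inr n)‖ₑ ^ r
    calc 6 * (c⁻¹ * ∑ x, ‖F a (.inl x)‖ₑ ^ r + B) ≤ 6 * (2 * (A + B) + B) := by gcongr
      _ = 12 * A + 18 * B := by ring
      _ ≤ 18 * A + 18 * B := by gcongr; norm_num
      _ = 18 * (A + B) := by ring
  · intro a x
    rw [hI]
    rcases x with x | n
    · refine (enorm_add_rpow_le _ _ hr hr2).trans ?_
      gcongr
      · exact Finset.single_le_sum (f := fun m => ‖a (.inl m)‖ₑ ^ r) (fun _ _ => zero_le)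
          (Finset.mem_univ x.1)
      · exact g.le_sum _ x
    · have h1 : ‖a (.inr n)‖ₑ ^ r ≤ ∑ n, ‖a (.inr n)‖ₑ ^ r :=
        Finset.single_le_sum (f := fun n => ‖a (.inr n)‖ₑ ^ r) (fun _ _ => zero_le)
          (Finset.mem_univ n)
      rw [hFr, two_mul]
      exact h1.trans (le_add_left le_rfl |>.trans le_self_add)
  · intro J hJ
    have hmeet : ∀ m, ∃ ω, Sum.inl (m, ω) ∈ J := by
      intro m
      obtain ⟨x, hxJ, hx⟩ := hJ (Pi.single (.inl m) 1) (by simp)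
      have h0 : (fun n => (Pi.single (.inl m) 1 : Fin g.M ⊕ g.N → 𝕜) (.inr n)) = 0 := by
        funext n; simp
      rcases x with ⟨m', ω⟩ | n
      · rw [hFl, h0, map_zero, Pi.zero_apply, add_zero] at hx
        have : m' = m := by
          by_contra hne
          exact hx (Pi.single_eq_of_ne (by simpa using hne) _)
        exact ⟨ω, this ▸ hxJ⟩
      · exact absurd (by rw [hFr]; simp) hx
    choose ω hω using hmeet
    obtain ⟨a, ha0, ha⟩ := g.gain ω
    refine ⟨Sum.elim 0 a, fun h => ha0 (funext fun n => congrFun h (.inr n)), ?_⟩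
    rw [hI]
    simp only [Sum.elim_inl, Pi.zero_apply, enorm_zero, ENNReal.zero_rpow_of_pos hr0,
      Finset.sum_const_zero, zero_add, Sum.elim_inr]
    refine ha.trans ?_
    have hinj : Function.Injective fun m => (Sum.inl (m, ω m) : (Fin g.M × g.Ω) ⊕ g.N) := by
      intro m m' h
      simpa using (congrArg Prod.fst (Sum.inl_injective h))
    calc ∑ m, ‖g.g a (m, ω m)‖ₑ ^ r
        = ∑ m, ‖F (Sum.elim 0 a) (.inl (m, ω m))‖ₑ ^ r := by
          refine Finset.sum_congr rfl fun m _ => ?_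
          rw [hFl]
          simp
      _ = ∑ x ∈ Finset.univ.image fun m => (Sum.inl (m, ω m) : (Fin g.M × g.Ω) ⊕ g.N),
            ‖F (Sum.elim 0 a) x‖ₑ ^ r := by
          rw [Finset.sum_image hinj.injOn]
      _ ≤ _ := Finset.sum_le_sum_of_subset fun x hx => by
          obtain ⟨m, -, rfl⟩ := Finset.mem_image.mp hx
          exact hω m

theorem nonempty_samplingBlock (𝕜 : Type*) [RCLike 𝕜] {r : ℝ} (hr : 1 ≤ r) (hr2 : r < 2) (G : ℕ) :
    Nonempty (SamplingBlock 𝕜 r G) :=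
  (nonempty_selectionGadget 𝕜 hr hr2 G).elim fun g => g.nonempty_samplingBlock hr hr2.le

/-! ### Step functions on the line -/

/-- A countable family of bounded weights is realized by the lengths of disjoint intervals. The map
`cell` sends a point to the index of the interval containing it, and to `none` outside of all of
them. -/
theorem exists_cell {Z : Type*} [Countable Z] (w : Z → ℝ≥0∞) (hw : ∀ z, w z ≤ 6) :
    ∃ cell : ℝ → Option Z,
      (∀ {β : Type _} [MeasurableSpace β] (f : Option Z → β), Measurable fun t => f (cell t)) ∧
      ∀ f : Option Z → ℝ≥0∞, f none = 0 → ∫⁻ t, f (cell t) = ∑' z, f (some z) * w z := by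
  classical
  obtain ⟨ι, hι⟩ := exists_injective_nat Z
  let S : Z → Set ℝ := fun z => Set.Ico (6 * (ι z : ℝ)) (6 * (ι z : ℝ) + (w z).toReal)
  have hw6 : ∀ z, (w z).toReal ≤ 6 := fun z =>
    ENNReal.toReal_le_of_le_ofReal (by norm_num) (by simpa using hw z)
  have hdisj : ∀ t z z', t ∈ S z → t ∈ S z' → z = z' := by
    intro t z z' h h'
    apply hι
    have h1 := hw6 z
    have h2 := hw6 z'
    obtain ⟨h3, h4⟩ := h
    obtain ⟨h5, h6⟩ := h'
    have h7 : (ι z : ℝ) < ι z' + 1 := by linarith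
    have h8 : (ι z' : ℝ) < ι z + 1 := by linarith
    have h9 : ι z < ι z' + 1 := by exact_mod_cast h7
    have h10 : ι z' < ι z + 1 := by exact_mod_cast h8
    omega
  let cell : ℝ → Option Z := fun t => if h : ∃ z, t ∈ S z then some h.choose else none
  have hcell : ∀ z, cell ⁻¹' {some z} = S z := by
    intro z
    ext t
    simp only [Set.mem_preimage, Set.mem_singleton_iff, cell]
    split_ifs with h
    · refine ⟨fun h' => ?_, fun h' => ?_⟩
      · rw [← Option.some_injective _ h']; exact h.choose_spec
      · rw [hdisj t _ _ h.choose_spec h']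
    · simpa using fun h' => h ⟨z, h'⟩
  let : MeasurableSpace (Option Z) := ⊤
  have hmeas : Measurable cell := by
    apply measurable_to_countable'
    rintro (_ | z)
    · have : cell ⁻¹' {none} = (⋃ z, S z)ᶜ := by
        ext t
        simp [cell]
      rw [this]
      exact (MeasurableSet.iUnion fun z => measurableSet_Ico).compl
    · rw [hcell]; exact measurableSet_Ico
  refine ⟨cell, fun f => measurable_from_top.comp hmeas, fun f hf => ?_⟩
  rw [← lintegral_map (measurable_from_top : Measurable f) hmeas, lintegral_countable',
    ← (Option.some_injective Z).tsum_eq]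
  · refine tsum_congr fun z => ?_
    rw [Measure.map_apply hmeas (measurableSet_singleton _), hcell, Real.volume_Ico,
      add_sub_cancel_left, ENNReal.ofReal_toReal (ne_top_of_le_ne_top (by norm_num) (hw z))]
  · rintro (_ | z) hz
    · simp [hf] at hz
    · exact ⟨z, rfl⟩

/-! ### Norms as sums and integrals of powers -/

theorem lp.enorm_rpow_eq_tsum {𝕜 ι : Type*} [NormedAddCommGroup 𝕜] {p : ℝ≥0∞}
    [Fact (1 ≤ p)] (hp : 0 < p.toReal) (a : lp (fun _ : ι => 𝕜) p) :
    ‖a‖ₑ ^ p.toReal = ∑' i, ‖a i‖ₑ ^ p.toReal := by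
  rw [enorm_rpow_eq_ofReal a hp.le, lp.norm_rpow_eq_tsum hp,
    ENNReal.ofReal_tsum_of_nonneg (fun i => by positivity) ((lp.memℓp a).summable hp)]
  exact tsum_congr fun i => (enorm_rpow_eq_ofReal _ hp.le).symm

theorem memℓp_of_tsum_enorm_rpow_ne_top {𝕜 ι : Type*} [NormedAddCommGroup 𝕜] {p : ℝ≥0∞}
    {a : ι → 𝕜} (h : ∑' i, ‖a i‖ₑ ^ p.toReal ≠ ∞) : Memℓp a p := by
  refine memℓp_gen ?_
  have := ENNReal.summable_toReal h
  refine this.congr fun i => ?_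
  rw [← ENNReal.toReal_rpow, toReal_enorm]

theorem eLpNorm_rpow_eq_lintegral {α E : Type*} [MeasurableSpace α] {μ : Measure α}
    [NormedAddCommGroup E] {p : ℝ≥0∞} (hp : 0 < p.toReal) (f : α → E) :
    eLpNorm f p μ ^ p.toReal = ∫⁻ t, ‖f t‖ₑ ^ p.toReal ∂μ := by
  obtain ⟨h0, ht⟩ := ENNReal.toReal_pos_iff.mp hp
  rw [eLpNorm_eq_lintegral_rpow_enorm_toReal h0.ne' ht.ne, ← ENNReal.rpow_mul,
    one_div_mul_cancel hp.ne', ENNReal.rpow_one]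

theorem exists_smul_sum_enorm_rpow_eq {𝕜 ι : Type*} [RCLike 𝕜] [Fintype ι] {r : ℝ} (hr : 0 < r)
    {a : ι → 𝕜} (ha : a ≠ 0) {ε : ℝ} (hε : 0 < ε) :
    ∃ c : 𝕜, ‖c‖ₑ ^ r * ∑ i, ‖a i‖ₑ ^ r = ENNReal.ofReal ε := by
  set S := ∑ i, ‖a i‖ ^ r with hS
  have hS0 : 0 < S := by
    obtain ⟨i, hi⟩ := Function.ne_iff.mp ha
    exact Finset.sum_pos' (fun i _ => by positivity)
      ⟨i, Finset.mem_univ _, Real.rpow_pos_of_pos (norm_pos_iff.mpr hi) r⟩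
  refine ⟨(((ε / S) ^ (1 / r) : ℝ) : 𝕜), ?_⟩
  rw [sum_enorm_rpow_eq_ofReal _ _ hr.le, enorm_rpow_eq_ofReal _ hr.le,
    ← ENNReal.ofReal_mul (by positivity), RCLike.norm_ofReal, abs_of_nonneg (by positivity),
    ← Real.rpow_mul (by positivity), one_div_mul_cancel hr.ne', Real.rpow_one, ← hS,
    div_mul_cancel₀ _ hS0.ne']

/-! ### The sum of the blocks -/

/-- For every `1 ≤ p < 2` there is a subspace `Y` of `L_p(ℝ)` (real or complex scalars), regarded as
a linear space of functions through a linear choice `ev` of representatives, so that `ev y t` is the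
value `y(t)`, such that `Y` is isomorphic to `ℓ_p`, the supremum of `|y(t)|` over all `t` is at most
the `L_p`-norm of `y`, and each set `J` of points that separates `Y` from zero admits a `y ∈ Y` with
`∑_{t ∈ J} |y(t)| ^ p = ∞`. -/
theorem proposition5p1 (𝕜 : Type*) [RCLike 𝕜] (p : ℝ≥0∞) [Fact (1 ≤ p)] (hp : p < 2) :
    ∃ (Y : Submodule 𝕜 (Lp 𝕜 p (volume : Measure ℝ))) (ev : Y →ₗ[𝕜] (ℝ → 𝕜)),
      (∀ y : Y, ev y =ᵐ[volume] ((y : Lp 𝕜 p (volume : Measure ℝ)) : ℝ → 𝕜)) ∧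
      Nonempty (Y ≃L[𝕜] lp (fun _ : ℕ => 𝕜) p) ∧
      (∀ (y : Y) (t : ℝ), ‖ev y t‖ ≤ ‖y‖) ∧
      ∀ J : Set ℝ, (∀ x : Y, x ≠ 0 → (⨆ t ∈ J, ‖ev x t‖ₑ) ≠ 0) →
        ∃ y : Y, ∑' t : J, ‖ev y t‖ₑ ^ p.toReal = ∞ := by
  classical
  have hpt : p ≠ ∞ := ne_top_of_lt hp
  have hr1 : 1 ≤ p.toReal := by
    simpa using ENNReal.toReal_mono hpt (Fact.out : 1 ≤ p)
  have hr2 : p.toReal < 2 := by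
    simpa using (ENNReal.toReal_lt_toReal hpt (by norm_num)).mpr hp
  have hr0 : 0 < p.toReal := by linarith
  set r := p.toReal with hr
  let B : ∀ k : ℕ, SamplingBlock 𝕜 r (4 ^ k) := fun k =>
    (nonempty_samplingBlock 𝕜 hr1 hr2 (4 ^ k)).some
  have : Infinite (Σ k, (B k).I) :=
    Infinite.of_injective (fun k : ℕ => ⟨k, Classical.arbitrary _⟩) fun k l h =>
      congrArg Sigma.fst h
  obtain ⟨e⟩ : Nonempty ((Σ k, (B k).I) ≃ ℕ) := nonempty_equiv_of_countable
  obtain ⟨cell, hcm, hci⟩ := exists_cell (Z := Σ k, (B k).X) (fun z => (B z.1).w z.2)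
    fun z => (B z.1).w_le z.2
  -- the coordinates belonging to the block `k`, and the step function with coefficients `a`
  let coord : ∀ k, (ℕ → 𝕜) →ₗ[𝕜] ((B k).I → 𝕜) := fun k => LinearMap.funLeft 𝕜 𝕜 fun i => e ⟨k, i⟩
  let val : (ℕ → 𝕜) → Option (Σ k, (B k).X) → 𝕜 := fun a o =>
    o.elim 0 fun z => (B z.1).F (coord z.1 a) z.2
  let step : (ℕ → 𝕜) →ₗ[𝕜] (ℝ → 𝕜) :=
    { toFun := fun a t => val a (cell t)
      map_add' := fun a b => by
        funext t
        rcases h : cell t with _ | z <;> simp [val, h]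
      map_smul' := fun c a => by
        funext t
        rcases h : cell t with _ | z <;> simp [val, h] }
  have hstep : ∀ a t z, cell t = some z → step a t = (B z.1).F (coord z.1 a) z.2 := by
    intro a t z h
    change val a (cell t) = _
    rw [h]
    rfl
  have hstep0 : ∀ a t, cell t = none → step a t = 0 := by
    intro a t h
    change val a (cell t) = _
    rw [h]
    rfl
  have hint : ∀ a, ∫⁻ t, ‖step a t‖ₑ ^ r
      = ∑' k, ∑ x, ‖(B k).F (coord k a) x‖ₑ ^ r * (B k).w x := by
    intro a
    refine (hci (fun o => ‖val a o‖ₑ ^ r) (by simp [val, hr0])).trans ?_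
    rw [ENNReal.tsum_sigma']
    exact tsum_congr fun k => tsum_fintype _
  have hcoord : ∀ a : ℕ → 𝕜, ∑' n, ‖a n‖ₑ ^ r = ∑' k, ∑ i, ‖coord k a i‖ₑ ^ r := by
    intro a
    rw [← e.tsum_eq, ENNReal.tsum_sigma']
    exact tsum_congr fun k => tsum_fintype _
  have hlow : ∀ a : ℕ → 𝕜, 2 * ∑' n, ‖a n‖ₑ ^ r ≤ ∫⁻ t, ‖step a t‖ₑ ^ r := by
    intro a
    rw [hint, hcoord, ← ENNReal.tsum_mul_left]
    exact ENNReal.tsum_le_tsum fun k => (B k).le_sum _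
  have hupp : ∀ a : ℕ → 𝕜, ∫⁻ t, ‖step a t‖ₑ ^ r ≤ 18 * ∑' n, ‖a n‖ₑ ^ r := by
    intro a
    rw [hint, hcoord, ← ENNReal.tsum_mul_left]
    exact ENNReal.tsum_le_tsum fun k => (B k).sum_le _
  have hsup : ∀ (a : ℕ → 𝕜) t, ‖step a t‖ₑ ^ r ≤ 2 * ∑' n, ‖a n‖ₑ ^ r := by
    intro a t
    rcases h : cell t with _ | z
    · simp [hstep0 a t h, hr0]
    · rw [hstep a t z h, hcoord]
      refine ((B z.1).apply_le _ _).trans ?_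
      gcongr
      exact ENNReal.le_tsum (f := fun k => ∑ i, ‖coord k a i‖ₑ ^ r) z.1
  have hmem : ∀ a : lp (fun _ : ℕ => 𝕜) p, MemLp (step a) p volume := by
    intro a
    refine ⟨(hcm (val a)).aestronglyMeasurable, ?_⟩
    rw [← ENNReal.rpow_lt_top_iff_of_pos hr0, eLpNorm_rpow_eq_lintegral hr0]
    refine (hupp a).trans_lt ?_
    rw [← lp.enorm_rpow_eq_tsum hr0]
    exact ENNReal.mul_lt_top (by norm_num) (ENNReal.rpow_lt_top_of_nonneg hr0.le (by simp))
  -- the isomorphism of `ℓ_p` onto `Y`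
  let V : lp (fun _ : ℕ => 𝕜) p →ₗ[𝕜] Lp 𝕜 p (volume : Measure ℝ) :=
    { toFun := fun a => (hmem a).toLp
      map_add' := fun a b => by
        rw [← MemLp.toLp_add]
        exact MemLp.toLp_congr _ _ (by rw [lp.coeFn_add, map_add])
      map_smul' := fun c a => by
        rw [RingHom.id_apply, ← MemLp.toLp_const_smul]
        exact MemLp.toLp_congr _ _ (by rw [lp.coeFn_smul, map_smul]) }
  have hV : ∀ a, ‖V a‖ₑ ^ r = ∫⁻ t, ‖step a t‖ₑ ^ r := by
    intro a
    rw [← eLpNorm_rpow_eq_lintegral hr0]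
    congr 1
    exact Lp.enorm_toLp (hmem a)
  have hVlow : ∀ a, ‖a‖ ≤ ‖V a‖ := by
    intro a
    rw [← enorm_le_iff_norm_le, ← ENNReal.rpow_le_rpow_iff hr0, hV, lp.enorm_rpow_eq_tsum hr0]
    refine le_trans ?_ (hlow a)
    rw [two_mul]
    exact le_self_add
  have hVupp : ∀ a, ‖V a‖ ≤ 18 * ‖a‖ := by
    intro a
    have : ‖V a‖ₑ ≤ 18 * ‖a‖ₑ := by
      rw [← ENNReal.rpow_le_rpow_iff hr0, hV, ENNReal.mul_rpow_of_nonneg _ _ hr0.le,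
        lp.enorm_rpow_eq_tsum hr0]
      refine (hupp a).trans ?_
      gcongr
      exact ENNReal.le_rpow_self_of_one_le (by norm_num) hr1
    simpa using ENNReal.toReal_mono (ENNReal.mul_ne_top (by norm_num) (by simp)) this
  have hinj : Function.Injective V := by
    rw [injective_iff_map_eq_zero]
    intro a h
    have := hVlow a
    rw [h, norm_zero] at this
    exact norm_le_zero_iff.mp this
  let T : lp (fun _ : ℕ => 𝕜) p ≃ₗ[𝕜] V.range := LinearEquiv.ofInjective V hinj
  have hT : ∀ a, ((T a : V.range) : Lp 𝕜 p (volume : Measure ℝ)) = V a := fun _ => rfl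
  let ev : V.range →ₗ[𝕜] (ℝ → 𝕜) :=
    { toFun := fun y => step (T.symm y)
      map_add' := fun x y => by rw [map_add, lp.coeFn_add, map_add]
      map_smul' := fun c x => by rw [map_smul, lp.coeFn_smul, map_smul, RingHom.id_apply] }
  have hev : ∀ a, ev (T a) = step a := fun a => by
    change step (T.symm (T a)) = _
    rw [T.symm_apply_apply]
  refine ⟨V.range, ev, ?_, ?_, ?_, ?_⟩
  · intro y
    obtain ⟨a, rfl⟩ := T.surjective y
    rw [hev, hT]
    exact (hmem a).coeFn_toLp.symm
  · refine ⟨(T.toContinuousLinearEquivOfBounds 18 1 hVupp fun y => ?_).symm⟩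
    obtain ⟨a, rfl⟩ := T.surjective y
    rw [T.symm_apply_apply, one_mul]
    exact hVlow a
  · intro y t
    obtain ⟨a, rfl⟩ := T.surjective y
    rw [hev]
    change ‖step a t‖ ≤ ‖V a‖
    rw [← enorm_le_iff_norm_le, ← ENNReal.rpow_le_rpow_iff hr0, hV]
    exact (hsup a t).trans (hlow a)
  · intro J hJ
    -- the points of the block `k` that are represented in `J`
    let Jb : ∀ k, Finset (B k).X := fun k =>
      Finset.univ.filter fun x => ∃ t ∈ J, cell t = some ⟨k, x⟩
    -- the sequence whose coordinates in the block `k` are `b k`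
    let glue : (∀ k, (B k).I → 𝕜) → ℕ → 𝕜 := fun b n => b (e.symm n).1 (e.symm n).2
    have hglue : ∀ b k, coord k (glue b) = b k := fun b k => by
      funext i
      change b (e.symm (e ⟨k, i⟩)).1 (e.symm (e ⟨k, i⟩)).2 = _
      rw [e.symm_apply_apply]
    -- `J` separates the block `k`, whose functions vanish on all other blocks
    have hsep : ∀ k (b : (B k).I → 𝕜), b ≠ 0 → ∃ x ∈ Jb k, (B k).F b x ≠ 0 := by
      intro k b hb
      have hmemℓp : Memℓp (glue (Pi.single k b)) p := by
        refine memℓp_of_tsum_enorm_rpow_ne_top ?_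
        rw [← hr, hcoord]
        simp only [hglue]
        rw [tsum_eq_single k fun l hl => by simp [Pi.single_eq_of_ne hl, hr0]]
        exact ENNReal.sum_ne_top.mpr fun i _ => ENNReal.rpow_ne_top_of_nonneg hr0.le (by simp)
      have hne : T ⟨_, hmemℓp⟩ ≠ 0 := by
        intro h0
        have h1 : glue (Pi.single k b) = 0 := congrArg Subtype.val (T.map_eq_zero_iff.mp h0)
        apply hb
        have h2 := hglue (Pi.single k b) k
        rwa [h1, map_zero, Pi.single_eq_same, eq_comm] at h2
      have hJx := hJ _ hne
      rw [hev] at hJx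
      obtain ⟨t, htJ, ht⟩ : ∃ t ∈ J, step (glue (Pi.single k b)) t ≠ 0 := by
        by_contra! hcon
        apply hJx
        simp only [ENNReal.iSup_eq_zero]
        intro t ht
        exact enorm_eq_zero.mpr (hcon t ht)
      rcases hc : cell t with _ | ⟨l, x⟩
      · exact absurd (hstep0 _ t hc) ht
      · rw [hstep _ t _ hc, hglue] at ht
        obtain rfl : l = k := by
          by_contra hl
          rw [Pi.single_eq_of_ne hl] at ht
          simp at ht
        rw [Pi.single_eq_same] at ht
        exact ⟨x, Finset.mem_filter.mpr ⟨Finset.mem_univ _, t, htJ, hc⟩, ht⟩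
    have hblock : ∀ k, ∃ b : (B k).I → 𝕜, ∑ i, ‖b i‖ₑ ^ r = ENNReal.ofReal ((1 / 2) ^ k) ∧
        2 ^ k ≤ ∑ x ∈ Jb k, ‖(B k).F b x‖ₑ ^ r := by
      intro k
      obtain ⟨b, hb, hgain⟩ := (B k).gain (Jb k) (hsep k)
      obtain ⟨c, hc⟩ := exists_smul_sum_enorm_rpow_eq hr0 hb (by positivity : (0 : ℝ) < (1 / 2) ^ k)
      refine ⟨c • b, ?_, ?_⟩
      · simp only [← hc, Pi.smul_apply, enorm_smul, ENNReal.mul_rpow_of_nonneg _ _ hr0.le,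
          Finset.mul_sum]
      · simp only [map_smul, Pi.smul_apply, enorm_smul, ENNReal.mul_rpow_of_nonneg _ _ hr0.le,
          ← Finset.mul_sum]
        refine le_trans (le_of_eq ?_) (mul_le_mul_right hgain _)
        rw [mul_left_comm, hc, ← ENNReal.ofReal_natCast, ← ENNReal.ofReal_mul (Nat.cast_nonneg _)]
        have h4 : ((4 ^ k : ℕ) : ℝ) * (1 / 2) ^ k = 2 ^ k := by
          push_cast
          rw [← mul_pow]
          norm_num
        rw [h4, ENNReal.ofReal_pow (by norm_num)]
        simp
    choose b hb hbJ using hblock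
    have ha : Memℓp (glue b) p := by
      refine memℓp_of_tsum_enorm_rpow_ne_top ?_
      rw [← hr, hcoord]
      simp only [hglue, hb]
      rw [← ENNReal.ofReal_tsum_of_nonneg (fun k => by positivity) summable_geometric_two]
      exact ENNReal.ofReal_ne_top
    refine ⟨T ⟨glue b, ha⟩, ?_⟩
    rw [hev]
    have hk : ∀ k : ℕ, (2 : ℝ≥0∞) ^ k ≤ ∑' t : J, ‖step (glue b) t‖ₑ ^ r := by
      intro k
      have hrep : ∀ x : Jb k, ∃ t : J, cell t = some ⟨k, x⟩ := fun x => by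
        obtain ⟨t, ht, hx⟩ := (Finset.mem_filter.mp x.2).2
        exact ⟨⟨t, ht⟩, hx⟩
      choose τ hτ using hrep
      have hτinj : Function.Injective τ := by
        intro x y hxy
        have h1 := hτ x
        rw [hxy, hτ y] at h1
        have h2 := Option.some_injective _ h1
        exact Subtype.ext (eq_of_heq (Sigma.mk.inj h2).2).symm
      calc (2 : ℝ≥0∞) ^ k ≤ ∑ x ∈ Jb k, ‖(B k).F (b k) x‖ₑ ^ r := hbJ k
        _ = ∑' x : Jb k, ‖step (glue b) (τ x)‖ₑ ^ r := by
            rw [tsum_fintype, ← Finset.sum_coe_sort]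
            exact Finset.sum_congr rfl fun x _ => by rw [hstep _ _ _ (hτ x), hglue]
        _ ≤ _ := ENNReal.tsum_comp_le_tsum_of_injective hτinj fun t : J => ‖step (glue b) t‖ₑ ^ r
    exact top_le_iff.mp (le_of_tendsto'
      (ENNReal.tendsto_pow_atTop_nhds_top_iff.mpr (by norm_num)) hk)
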